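/- Let $\mathcal X$ be a set of datasets with a neighboring relation and let $\mathcal Y$ be a measurable space. For probability measures $P,Q$ on $\mathcal Y$ and $\alpha>1$ let $D_\alpha(P\|Q)=\frac1{\alpha-1}\log \mathbb E_{z\sim P}\big[\big(\tfrac{dP}{dQ}(z)\big)^{\alpha-1}\big]$ if $P\ll Q$, and $D_\alpha(P\|Q)=+\infty$ otherwise. A randomized algorithm $M:\mathcal X\to\mathcal Y$ is *$\delta$-approximately $(\xi,\rho)$-zCDP* if for all neighbors $x,x'$ there are events $E,E'$ (of the probability spaces carrying the random outputs $M(x)$ and $M(x')$) with $\Pr[E],\Pr[E']\ge 1-\delta$ such that, for every $\alpha>1$, $$D_\alpha\big(M(x)|_E\,\|\,M(x')|_{E'}\big)\le \alpha\rho+\xi\quad\text{and}\quad D_\alpha\big(M(x')|_{E'}\,\|\,M(x)|_{E}\big)\le \alpha\rho+\xi ,$$ where $M(x)|_E$ is the law of $M(x)$ conditioned on $E$. Let $\mathcal E=\{(\delta_i,\xi_i,\rho_i): i\in[k]\}$ be a family of parameters with $\delta_i,\rho_i\ge 0$ and $\xi_i\in\mathbb R$. For $b\in\{0,1\}$, *experiment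 $b$* consists of $k$ rounds. In each round a deterministic analyst, depending on the outcomes of the previous rounds, selects an index $j\in[k]$ that was not selected before, a $\delta_j$-approximately $(\xi_j,\rho_j)$-zCDP mechanism $M:\mathcal X\to\mathcal Y$, and neighboring datasets $x^{(0)},x^{(1)}$; the analyst then receives an outcome drawn from $M(x^{(b)})$ with fresh randomness. (The law of this outcome is assumed to depend measurably on the previous outcomes.) Let $V^{(b)}\in\mathcal Y^k$ be the view of the analyst, that is, the sequence of the $k$ outcomes. **Lemma.** For every $\delta>0$ put $$\varepsilon_g=\sum_{i\in[k]}(\xi_i+\rho_i)+2\sqrt{\sum_{i\in[k]}\rho_i\log(1/\delta)}$$ (the square root of a negative number, which can occur only for $\delta>1$, being read as $0$). Then $\mathcal E$ is $(\varepsilon_g,\ \delta+\sum_{i\in[k]}\delta_i)$-differentially private under set-wise adaptive composition: for every such analyst, every $b\in\{0,1\}$ and every measurable $S\subseteq\mathcal Y^k$, $$\Pr[V^{(b)}\in S]\le e^{\varepsilon_g}\Pr[V^{(1-b)}\in S]+\delta+\sum_{i\in[k]}\delta_i .$$ -/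

import Mathlib

open MeasureTheory ProbabilityTheory

universe u v

noncomputable section

namespace SetwiseComposition

open scoped Classical in
/-- The Rényi divergence of order `α` (used for `α > 1`),
`D_α(P ‖ Q) = (α - 1)⁻¹ log E_{z ∼ P} [(dP/dQ (z)) ^ (α - 1)]`,
with value `+∞` when `P` is not absolutely continuous with respect to `Q`. -/
def renyiDiv {Y : Type v} [MeasurableSpace Y] (α : ℝ) (P Q : Measure Y) : EReal :=
  if P ≪ Q then
    (((α - 1)⁻¹ : ℝ) : EReal) * ENNReal.log (∫⁻ z, (P.rnDeriv Q z) ^ (α - 1) ∂P)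
  else ⊤

/-- A randomized output with law `ν`, realised as a random variable `Z` on some probability space
`(Ω, P)` (the coins of the algorithm), together with an event `E` of that probability space. The
event may depend on all the randomness in `Ω`, not only on the value of the output. -/
structure OutputWithEvent {Y : Type v} [MeasurableSpace Y] (ν : Measure Y) where
  Ω : Type v
  mΩ : MeasurableSpace Ω
  P : Measure Ω
  isProbabilityMeasure : IsProbabilityMeasure P
  Z : Ω → Y
  measurable_Z : Measurable Z
  map_Z : P.map Z = ν
  E : Set Ω
  measurableSet_E : MeasurableSet E

attribute [instance] OutputWithEvent.mΩ OutputWithEvent.isProbabilityMeasure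

/-- The probability `Pr[E]` of the event. -/
def OutputWithEvent.prob {Y : Type v} [MeasurableSpace Y] {ν : Measure Y}
    (R : OutputWithEvent ν) : ℝ :=
  R.P.real R.E

/-- The law of the output conditioned on the event `E`. -/
def OutputWithEvent.condLaw {Y : Type v} [MeasurableSpace Y] {ν : Measure Y}
    (R : OutputWithEvent ν) : Measure Y :=
  (ProbabilityTheory.cond R.P R.E).map R.Z

/-- A triple `(δ, ξ, ρ)` of approximate zCDP parameters. -/
structure ZCDPParam where
  δ : ℝ
  ξ : ℝ
  ρ : ℝ

/-- The randomized algorithm `M : X → Y`, given by the law `M x` of its output on each input `x`,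
is `δ`-approximately `(ξ, ρ)`-zCDP with respect to the neighboring relation `Neighbor`. -/
def IsApproxZCDP {X : Type u} {Y : Type v} [MeasurableSpace Y] (Neighbor : X → X → Prop)
    (p : ZCDPParam) (M : X → ProbabilityMeasure Y) : Prop :=
  ∀ x x' : X, Neighbor x x' →
    ∃ (R : OutputWithEvent (M x : Measure Y)) (R' : OutputWithEvent (M x' : Measure Y)),
      1 - p.δ ≤ R.prob ∧ 1 - p.δ ≤ R'.prob ∧
        ∀ α : ℝ, 1 < α →
          renyiDiv α R.condLaw R'.condLaw ≤ ((α * p.ρ + p.ξ : ℝ) : EReal) ∧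
          renyiDiv α R'.condLaw R.condLaw ≤ ((α * p.ρ + p.ξ : ℝ) : EReal)

/-- A (deterministic, adaptive) analyst in the set-wise adaptive composition experiment with the
parameters `𝓔 i`, `i ∈ [k]`. In round `i`, having seen the outcomes `h : Fin i → Y` of the
previous rounds, the analyst selects the parameters with index `index i h`, which were not
selected in an earlier round, a mechanism `mech i h` satisfying approximate zCDP with the selected
parameters, and two neighboring datasets `data i h false` and `data i h true`. -/
structure Analyst {X : Type u} (Neighbor : X → X → Prop) (Y : Type v) [MeasurableSpace Y]
    {k : ℕ} (𝓔 : Fin k → ZCDPParam) where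
  index : (i : Fin k) → (Fin i → Y) → Fin k
  mech : (i : Fin k) → (Fin i → Y) → X → ProbabilityMeasure Y
  data : (i : Fin k) → (Fin i → Y) → Bool → X
  index_ne : ∀ (i j : Fin k) (hji : j < i) (h : Fin i → Y),
    index j (fun l => h (Fin.castLE hji.le l)) ≠ index i h
  mech_zCDP : ∀ (i : Fin k) (h : Fin i → Y), IsApproxZCDP Neighbor (𝓔 (index i h)) (mech i h)
  neighbor : ∀ (i : Fin k) (h : Fin i → Y), Neighbor (data i h false) (data i h true)
  /-- The law of the outcome of round `i` is a measurable function of the previous outcomes. -/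
  measurable_law : ∀ (i : Fin k) (b : Bool),
    Measurable fun h : Fin i → Y => (mech i h (data i h b) : Measure Y)

namespace Analyst

variable {X : Type u} {Neighbor : X → X → Prop} {Y : Type v} [MeasurableSpace Y]
  {k : ℕ} {𝓔 : Fin k → ZCDPParam}

/-- The conditional law of the outcome of round `i` in experiment `b`, given the previous
outcomes. -/
def outcomeKernel (A : Analyst Neighbor Y 𝓔) (b : Bool) (i : Fin k) :
    Kernel (Fin i → Y) Y where
  toFun h := (A.mech i h (A.data i h b) : Measure Y)
  measurable' := A.measurable_law i b

/-- The joint law of the outcomes of the first `n` rounds in experiment `b`. -/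
def viewUpTo (A : Analyst Neighbor Y 𝓔) (b : Bool) : (n : ℕ) → n ≤ k → Measure (Fin n → Y)
  | 0, _ => Measure.dirac Fin.elim0
  | n + 1, hn =>
      ((A.viewUpTo b n (Nat.le_of_succ_le hn)).compProd (A.outcomeKernel b ⟨n, hn⟩)).map
        fun p : (Fin n → Y) × Y => (Fin.snoc p.1 p.2 : Fin (n + 1) → Y)

/-- The law of the view `V^{(b)}` of the analyst in experiment `b`. As the analyst is
deterministic, the view consists of the outcomes of the `k` rounds, which determine all the
selections of the analyst. -/
def view (A : Analyst Neighbor Y 𝓔) (b : Bool) : Measure (Fin k → Y) :=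
  A.viewUpTo b k le_rfl

instance isMarkovKernel_outcomeKernel (A : Analyst Neighbor Y 𝓔) (b : Bool) (i : Fin k) :
    IsMarkovKernel (A.outcomeKernel b i) :=
  ⟨fun h => inferInstanceAs (IsProbabilityMeasure (A.mech i h (A.data i h b) : Measure Y))⟩

theorem measurable_snoc (n : ℕ) :
    Measurable fun p : (Fin n → Y) × Y => (Fin.snoc p.1 p.2 : Fin (n + 1) → Y) := by
  refine measurable_pi_lambda _ fun i => ?_
  refine Fin.lastCases ?_ (fun j => ?_) i
  · simpa using measurable_snd
  · simpa [Function.comp_def] using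
      (measurable_pi_apply (X := fun _ : Fin n => Y) j).comp
        (measurable_fst (α := Fin n → Y) (β := Y))

theorem isProbabilityMeasure_viewUpTo (A : Analyst Neighbor Y 𝓔) (b : Bool) (n : ℕ)
    (hn : n ≤ k) : IsProbabilityMeasure (A.viewUpTo b n hn) := by
  induction n with
  | zero => exact inferInstanceAs (IsProbabilityMeasure (Measure.dirac _))
  | succ n ih =>
    have := ih (Nat.le_of_succ_le hn)
    let κ : Kernel (Fin n → Y) Y := A.outcomeKernel b ⟨n, hn⟩
    have hκ : IsMarkovKernel κ := A.isMarkovKernel_outcomeKernel b ⟨n, hn⟩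
    have : IsProbabilityMeasure ((A.viewUpTo b n (Nat.le_of_succ_le hn)).compProd κ) :=
      inferInstance
    exact Measure.isProbabilityMeasure_map (measurable_snoc n).aemeasurable

instance isProbabilityMeasure_view (A : Analyst Neighbor Y 𝓔) (b : Bool) :
    IsProbabilityMeasure (A.view b) :=
  A.isProbabilityMeasure_viewUpTo b k le_rfl

end Analyst

/-- `𝓔` is `(ε, δ)`-differentially private under set-wise adaptive composition, where approximate
zCDP mechanisms (with inputs in `X` and outcomes in `Y`) are selected at each round. -/
def IsSetwiseAdaptiveDP {X : Type u} (Neighbor : X → X → Prop) (Y : Type v) [MeasurableSpace Y]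
    {k : ℕ} (𝓔 : Fin k → ZCDPParam) (ε δ : ℝ) : Prop :=
  ∀ (A : Analyst Neighbor Y 𝓔) (b : Bool) (S : Set (Fin k → Y)), MeasurableSet S →
    (A.view b).real S ≤ Real.exp ε * (A.view (!b)).real S + δ

end SetwiseComposition

end

/-!
Hölder's inequality turns a bound `D_α(P ‖ Q) ≤ c` into the trade-off
`P(S) ≤ (exp c * Q(S)) ^ ((α - 1) / α)`, and, more generally, into a bound on `∫ f ∂P` for every
test `f ≤ (exp c' * g) ^ ((α - 1) / α)` in terms of `∫ g ∂Q`, in which the exponents `c` and `c'`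
add up. Going backwards through the rounds, each round thus moves the cost of the index it selects
from the bound on the test to the bound on its expectation. No index is selected twice, so whatever
the outcomes are, the total cost is the sum over all indices. Only inequalities between
expectations are propagated, so the events that witness approximate zCDP need not depend measurably
on the history. Young's inequality and the optimal choice of `α` turn the resulting trade-off for
the view into `(ε, δ)`-differential privacy.
-/

namespace SetwiseComposition

open scoped ENNReal

theorem sub_one_div_self_nonneg {α : ℝ} (hα : 1 ≤ α) : 0 ≤ (α - 1) / α :=
  div_nonneg (sub_nonneg.2 hα) (zero_le_one.trans hα)

theorem sub_one_div_self_le_one {α : ℝ} (hα : 0 ≤ α) : (α - 1) / α ≤ 1 :=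
  div_le_one_of_le₀ (sub_le_self α zero_le_one) hα

theorem lintegral_le_lintegral_add_measure_univ_sub {Y : Type*} [MeasurableSpace Y]
    {μ ν : Measure Y} [IsFiniteMeasure μ] (hμν : μ ≤ ν) {f : Y → ℝ≥0∞} (hf : ∀ y, f y ≤ 1) :
    ∫⁻ y, f y ∂ν ≤ ∫⁻ y, f y ∂μ + (ν Set.univ - μ Set.univ) :=
  calc ∫⁻ y, f y ∂ν = ∫⁻ y, f y ∂μ + ∫⁻ y, f y ∂(ν - μ) := by
        rw [← lintegral_add_measure, add_comm μ, Measure.sub_add_cancel_of_le hμν]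
    _ ≤ ∫⁻ y, f y ∂μ + ∫⁻ _, 1 ∂(ν - μ) := by
        gcongr
        exact hf _
    _ = ∫⁻ y, f y ∂μ + (ν Set.univ - μ Set.univ) := by
        rw [lintegral_one, Measure.sub_apply MeasurableSet.univ hμν]

section RenyiDivergence

variable {Y : Type v} [MeasurableSpace Y] {α c : ℝ} {P Q : Measure Y}

theorem absolutelyContinuous_of_renyiDiv_le (h : renyiDiv α P Q ≤ (c : EReal)) : P ≪ Q := by
  by_contra hPQ
  rw [renyiDiv, if_neg hPQ] at h
  exact (EReal.coe_lt_top c).not_ge h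

theorem lintegral_rnDeriv_rpow_le_of_renyiDiv_le (hα : 1 < α)
    (h : renyiDiv α P Q ≤ (c : EReal)) :
    ∫⁻ z, P.rnDeriv Q z ^ (α - 1) ∂P ≤ ENNReal.ofReal (Real.exp c) ^ (α - 1) := by
  have hα' : (0 : EReal) < ((α - 1 : ℝ) : EReal) := EReal.coe_pos.2 (sub_pos.2 hα)
  rw [renyiDiv, if_pos (absolutelyContinuous_of_renyiDiv_le h), EReal.coe_inv,
    ← EReal.div_eq_inv_mul] at h
  rw [← ENNReal.log_le_log_iff, ENNReal.log_rpow, ← EReal.exp_coe, EReal.log_exp]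
  exact (EReal.div_le_iff_le_mul hα' (EReal.coe_ne_top _)).1 h

theorem lintegral_rpow_le_lintegral_rnDeriv_rpow_mul [P.HaveLebesgueDecomposition Q] (hα : 1 < α)
    (hPQ : P ≪ Q) {g : Y → ℝ≥0∞} (hg : Measurable g) :
    ∫⁻ y, g y ^ ((α - 1) / α) ∂P ≤
      (∫⁻ y, P.rnDeriv Q y ^ (α - 1) ∂P) ^ (1 / α) * (∫⁻ y, g y ∂Q) ^ ((α - 1) / α) := by
  have hα0 : 0 < α := one_pos.trans hα
  have hα1 : 0 < α - 1 := sub_pos.2 hα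
  have hD : Measurable (P.rnDeriv Q) := Measure.measurable_rnDeriv P Q
  have moment_eq : ∫⁻ y, P.rnDeriv Q y ^ (α - 1) ∂P = ∫⁻ y, P.rnDeriv Q y ^ α ∂Q := by
    rw [← lintegral_rnDeriv_mul hPQ (hD.pow_const _).aemeasurable]
    refine lintegral_congr fun y => ?_
    nth_rw 1 [← ENNReal.rpow_one (P.rnDeriv Q y)]
    rw [← ENNReal.rpow_add_of_nonneg _ _ zero_le_one hα1.le, add_sub_cancel]
  have rpow_conj (y : Y) : (g y ^ ((α - 1) / α)) ^ (α / (α - 1)) = g y := by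
    rw [← ENNReal.rpow_mul, div_mul_div_cancel₀ hα0.ne', div_self hα1.ne', ENNReal.rpow_one]
  have holder := ENNReal.lintegral_mul_le_Lp_mul_Lq Q (Real.HolderConjugate.conjExponent hα)
    hD.aemeasurable (hg.pow_const ((α - 1) / α)).aemeasurable
  rw [moment_eq, ← lintegral_rnDeriv_mul hPQ (hg.pow_const _).aemeasurable]
  simpa only [Real.conjExponent, Pi.mul_apply, rpow_conj, one_div_div] using holder

theorem lintegral_rpow_le_of_renyiDiv_le [P.HaveLebesgueDecomposition Q] (hα : 1 < α)
    (h : renyiDiv α P Q ≤ (c : EReal)) {g : Y → ℝ≥0∞} (hg : Measurable g) :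
    ∫⁻ y, g y ^ ((α - 1) / α) ∂P ≤
      (ENNReal.ofReal (Real.exp c) * ∫⁻ y, g y ∂Q) ^ ((α - 1) / α) := by
  have hθ := sub_one_div_self_nonneg hα.le
  calc ∫⁻ y, g y ^ ((α - 1) / α) ∂P
      ≤ (∫⁻ y, P.rnDeriv Q y ^ (α - 1) ∂P) ^ (1 / α) * (∫⁻ y, g y ∂Q) ^ ((α - 1) / α) :=
        lintegral_rpow_le_lintegral_rnDeriv_rpow_mul hα (absolutelyContinuous_of_renyiDiv_le h) hg
    _ ≤ (ENNReal.ofReal (Real.exp c) ^ (α - 1)) ^ (1 / α) * (∫⁻ y, g y ∂Q) ^ ((α - 1) / α) := by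
        gcongr
        exact lintegral_rnDeriv_rpow_le_of_renyiDiv_le hα h
    _ = (ENNReal.ofReal (Real.exp c) * ∫⁻ y, g y ∂Q) ^ ((α - 1) / α) := by
        rw [← ENNReal.rpow_mul, mul_one_div, ENNReal.mul_rpow_of_nonneg _ _ hθ]

end RenyiDivergence

/-- `TradeoffTransfer μ ν Φ Ψ` says that every pair of tests `f`, `g` with values related by the
trade-off functions `Φ ω` has expectations related by the trade-off function `Ψ`. When `ω` is the
history of an experiment, `Φ ω` is the trade-off that the rounds after `ω` may still use up, and
`Ψ` is the one achieved by the whole experiment. -/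
def TradeoffTransfer {Ω : Type*} [MeasurableSpace Ω] (μ ν : Measure Ω) (Φ : Ω → ℝ≥0∞ → ℝ≥0∞)
    (Ψ : ℝ≥0∞ → ℝ≥0∞) : Prop :=
  ∀ f g : Ω → ℝ≥0∞, Measurable f → Measurable g → (∀ ω, f ω ≤ 1) → (∀ ω, f ω ≤ Φ ω (g ω)) →
    ∫⁻ ω, f ω ∂μ ≤ Ψ (∫⁻ ω, g ω ∂ν)

namespace TradeoffTransfer

variable {Ω Ω' : Type*} [MeasurableSpace Ω] [MeasurableSpace Ω'] {μ ν : Measure Ω}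
  {Φ : Ω → ℝ≥0∞ → ℝ≥0∞} {Ψ : ℝ≥0∞ → ℝ≥0∞}

theorem dirac (Φ : Ω → ℝ≥0∞ → ℝ≥0∞) (ω : Ω) :
    TradeoffTransfer (Measure.dirac ω) (Measure.dirac ω) Φ (Φ ω) := by
  intro f g hf hg _ hfg
  rw [lintegral_dirac' ω hf, lintegral_dirac' ω hg]
  exact hfg ω

theorem map {e : Ω → Ω'} (he : Measurable e) {Φ' : Ω' → ℝ≥0∞ → ℝ≥0∞}
    (h : TradeoffTransfer μ ν (fun ω => Φ' (e ω)) Ψ) :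
    TradeoffTransfer (μ.map e) (ν.map e) Φ' Ψ := by
  intro f g hf hg hf_le_one hfg
  rw [lintegral_map hf he, lintegral_map hg he]
  exact h _ _ (hf.comp he) (hg.comp he) (fun ω => hf_le_one (e ω)) fun ω => hfg (e ω)

theorem compProd [SFinite μ] [SFinite ν] {κ η : Kernel Ω Ω'} [IsMarkovKernel κ]
    [IsSFiniteKernel η] {Φ' : Ω × Ω' → ℝ≥0∞ → ℝ≥0∞} (h : TradeoffTransfer μ ν Φ Ψ)
    (hκη : ∀ ω, TradeoffTransfer (κ ω) (η ω) (fun ω' => Φ' (ω, ω')) (Φ ω)) :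
    TradeoffTransfer (μ ⊗ₘ κ) (ν ⊗ₘ η) Φ' Ψ := by
  intro f g hf hg hf_le_one hfg
  rw [Measure.lintegral_compProd hf, Measure.lintegral_compProd hg]
  refine h _ _ hf.lintegral_kernel_prod_right' hg.lintegral_kernel_prod_right' (fun ω => ?_)
    fun ω => hκη ω _ _ (hf.comp measurable_prodMk_left) (hg.comp measurable_prodMk_left)
      (fun ω' => hf_le_one (ω, ω')) fun ω' => hfg (ω, ω')
  calc ∫⁻ ω', f (ω, ω') ∂κ ω ≤ ∫⁻ _, 1 ∂κ ω := lintegral_mono fun ω' => hf_le_one (ω, ω')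
    _ = 1 := by rw [lintegral_one, measure_univ]

theorem measure_le (h : TradeoffTransfer μ ν Φ Ψ) {S : Set Ω} (hS : MeasurableSet S)
    (hΦ : ∀ ω ∈ S, 1 ≤ Φ ω 1) : μ S ≤ Ψ (ν S) := by
  have hind : Measurable (S.indicator (1 : Ω → ℝ≥0∞)) := measurable_one.indicator hS
  have key := h _ _ hind hind (Set.indicator_le_self' fun _ _ => zero_le_one) fun ω => by
    by_cases hω : ω ∈ S
    · simpa only [Set.indicator_of_mem hω, Pi.one_apply] using hΦ ω hω
    · simp only [Set.indicator_of_notMem hω, zero_le]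
  rwa [lintegral_indicator_one hS, lintegral_indicator_one hS] at key

end TradeoffTransfer

/-- The trade-off between the probabilities of an event under two laws whose Rényi divergence of
order `α` is at most `c` once an event of probability `δ` is discarded. -/
noncomputable def renyiTradeoff (α c δ : ℝ) (t : ℝ≥0∞) : ℝ≥0∞ :=
  (ENNReal.ofReal (Real.exp c) * t) ^ ((α - 1) / α) + ENNReal.ofReal δ

section RenyiTradeoff

variable {α c δ : ℝ}

theorem renyiTradeoff_mono (hα : 1 ≤ α) : Monotone (renyiTradeoff α c δ) := by
  intro t u htu
  have := sub_one_div_self_nonneg hα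
  unfold renyiTradeoff
  gcongr

theorem mul_renyiTradeoff_le (hα : 1 ≤ α) {s : ℝ≥0∞} (hs : s ≤ 1) (t : ℝ≥0∞) :
    s * renyiTradeoff α c δ t ≤ renyiTradeoff α c δ (s * t) := by
  have hθ := sub_one_div_self_nonneg hα
  have hsθ : s ≤ s ^ ((α - 1) / α) := by
    simpa only [ENNReal.rpow_one] using
      ENNReal.rpow_le_rpow_of_exponent_ge hs (sub_one_div_self_le_one (one_pos.trans_le hα).le)
  rw [renyiTradeoff, renyiTradeoff, mul_left_comm, ENNReal.mul_rpow_of_nonneg s _ hθ, mul_add]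
  exact add_le_add (mul_le_mul_left hsθ _) (mul_le_of_le_one_left zero_le hs)

theorem renyiTradeoff_zero_zero_one (α : ℝ) : renyiTradeoff α 0 0 1 = 1 := by
  simp [renyiTradeoff]

theorem renyiTradeoff_ne_top (hα : 1 ≤ α) {t : ℝ≥0∞} (ht : t ≠ ∞) :
    renyiTradeoff α c δ t ≠ ∞ := by
  have hθ := sub_one_div_self_nonneg hα
  exact ENNReal.add_ne_top.2 ⟨ENNReal.rpow_ne_top_of_nonneg hθ
    (ENNReal.mul_ne_top ENNReal.ofReal_ne_top ht), ENNReal.ofReal_ne_top⟩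

theorem toReal_renyiTradeoff (hα : 1 ≤ α) (hδ : 0 ≤ δ) {t : ℝ≥0∞} (ht : t ≠ ∞) :
    (renyiTradeoff α c δ t).toReal = (Real.exp c * t.toReal) ^ ((α - 1) / α) + δ := by
  have hne := ENNReal.add_ne_top.1 (renyiTradeoff_ne_top (c := c) (δ := δ) hα ht)
  rw [renyiTradeoff, ENNReal.toReal_add hne.1 hne.2, ← ENNReal.toReal_rpow,
    ENNReal.toReal_mul, ENNReal.toReal_ofReal (Real.exp_pos c).le, ENNReal.toReal_ofReal hδ]

variable {Y : Type v} [MeasurableSpace Y]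

theorem tradeoffTransfer_of_renyiDiv_le {P Q : Measure Y} [IsProbabilityMeasure P]
    [P.HaveLebesgueDecomposition Q] (hα : 1 < α) (h : renyiDiv α P Q ≤ (c : EReal))
    (c' δ' : ℝ) :
    TradeoffTransfer P Q (fun _ => renyiTradeoff α c' δ') (renyiTradeoff α (c + c') δ') := by
  intro f g _ hg _ hfg
  have hcg : Measurable fun y => ENNReal.ofReal (Real.exp c') * g y := hg.const_mul _
  calc ∫⁻ y, f y ∂P
      ≤ ∫⁻ y, ((ENNReal.ofReal (Real.exp c') * g y) ^ ((α - 1) / α) + ENNReal.ofReal δ') ∂P :=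
        lintegral_mono hfg
    _ = ∫⁻ y, (ENNReal.ofReal (Real.exp c') * g y) ^ ((α - 1) / α) ∂P + ENNReal.ofReal δ' := by
        rw [lintegral_add_right _ measurable_const, lintegral_const, measure_univ, mul_one]
    _ ≤ (ENNReal.ofReal (Real.exp c) * ∫⁻ y, ENNReal.ofReal (Real.exp c') * g y ∂Q)
          ^ ((α - 1) / α) + ENNReal.ofReal δ' := by
        gcongr
        exact lintegral_rpow_le_of_renyiDiv_le hα h hcg
    _ = renyiTradeoff α (c + c') δ' (∫⁻ y, g y ∂Q) := by
        rw [renyiTradeoff, lintegral_const_mul _ hg, Real.exp_add,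
          ENNReal.ofReal_mul (Real.exp_pos c).le, mul_assoc]

theorem TradeoffTransfer.of_smul_le {μ μ' ν ν' : Measure Y} [IsProbabilityMeasure μ]
    [IsProbabilityMeasure ν] {Φ : Y → ℝ≥0∞ → ℝ≥0∞} {δ' : ℝ} (hα : 1 ≤ α) (hδ0 : 0 ≤ δ)
    (hδ1 : δ ≤ 1) (hδ' : 0 ≤ δ') (hμν : ENNReal.ofReal (1 - δ) • μ ≤ ν)
    (hμν' : ENNReal.ofReal (1 - δ) • μ' ≤ ν')
    (h : TradeoffTransfer μ μ' Φ (renyiTradeoff α c δ')) :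
    TradeoffTransfer ν ν' Φ (renyiTradeoff α c (δ + δ')) := by
  intro f g hf hg hf_le_one hfg
  set s := ENNReal.ofReal (1 - δ) with hs
  have hs1 : s ≤ 1 := ENNReal.ofReal_le_one.2 (sub_le_self 1 hδ0)
  have : IsFiniteMeasure (s • μ) := isFiniteMeasure_of_le ν hμν
  have hrest : ν Set.univ - (s • μ) Set.univ = ENNReal.ofReal δ := by
    rw [Measure.smul_apply, measure_univ, measure_univ, smul_eq_mul, mul_one, hs,
      ← ENNReal.ofReal_one, ← ENNReal.ofReal_sub _ (sub_nonneg.2 hδ1), sub_sub_cancel]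
  calc ∫⁻ y, f y ∂ν
      ≤ ∫⁻ y, f y ∂(s • μ) + ENNReal.ofReal δ :=
        hrest ▸ lintegral_le_lintegral_add_measure_univ_sub hμν hf_le_one
    _ = s * ∫⁻ y, f y ∂μ + ENNReal.ofReal δ := by rw [lintegral_smul_measure, smul_eq_mul]
    _ ≤ s * renyiTradeoff α c δ' (∫⁻ y, g y ∂μ') + ENNReal.ofReal δ := by
        gcongr
        exact h f g hf hg hf_le_one hfg
    _ ≤ renyiTradeoff α c δ' (∫⁻ y, g y ∂(s • μ')) + ENNReal.ofReal δ := by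
        gcongr
        rw [lintegral_smul_measure, smul_eq_mul]
        exact mul_renyiTradeoff_le hα hs1 _
    _ ≤ renyiTradeoff α c δ' (∫⁻ y, g y ∂ν') + ENNReal.ofReal δ := by
        gcongr
        exact renyiTradeoff_mono hα (lintegral_mono' hμν' le_rfl)
    _ = renyiTradeoff α c (δ + δ') (∫⁻ y, g y ∂ν') := by
        rw [renyiTradeoff, renyiTradeoff, add_comm δ, ENNReal.ofReal_add hδ' hδ0, add_assoc]

end RenyiTradeoff

namespace OutputWithEvent

variable {Y : Type v} [MeasurableSpace Y] {ν ν' : Measure Y}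

theorem isProbabilityMeasure_condLaw (R : OutputWithEvent ν) (h : 0 < R.prob) :
    IsProbabilityMeasure R.condLaw := by
  have hE : R.P R.E ≠ 0 := (measureReal_ne_zero_iff).1 h.ne'
  have := cond_isProbabilityMeasure hE
  exact Measure.isProbabilityMeasure_map R.measurable_Z.aemeasurable

theorem smul_condLaw_le (R : OutputWithEvent ν) : R.P R.E • R.condLaw ≤ ν := by
  refine Measure.le_iff.2 fun S hS => ?_
  calc R.P R.E * R.condLaw S = R.P (R.E ∩ R.Z ⁻¹' S) := by
        rw [condLaw, Measure.map_apply R.measurable_Z hS, mul_comm,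
          cond_mul_eq_inter R.measurableSet_E]
    _ ≤ R.P (R.Z ⁻¹' S) := measure_mono Set.inter_subset_right
    _ = R.P.map R.Z S := (Measure.map_apply R.measurable_Z hS).symm
    _ = ν S := by rw [R.map_Z]

theorem ofReal_smul_condLaw_le (R : OutputWithEvent ν) {p : ℝ} (hp : p ≤ R.prob) :
    ENNReal.ofReal p • R.condLaw ≤ ν := by
  refine le_trans ?_ R.smul_condLaw_le
  gcongr
  exact ENNReal.ofReal_le_of_le_toReal hp

theorem tradeoffTransfer [IsProbabilityMeasure ν] (R : OutputWithEvent ν)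
    (R' : OutputWithEvent ν') {α c δ : ℝ} (hα : 1 < α) (hδ0 : 0 ≤ δ)
    (hR : 1 - δ ≤ R.prob) (hR' : 1 - δ ≤ R'.prob)
    (hdiv : renyiDiv α R.condLaw R'.condLaw ≤ (c : EReal)) (c' : ℝ) {δ' : ℝ} (hδ' : 0 ≤ δ') :
    TradeoffTransfer ν ν' (fun _ => renyiTradeoff α c' δ')
      (renyiTradeoff α (c + c') (δ + δ')) := by
  rcases lt_or_ge δ 1 with hδ1 | hδ1
  · have hprob : 0 < 1 - δ := sub_pos.2 hδ1
    have := R.isProbabilityMeasure_condLaw (hprob.trans_le hR)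
    have := R'.isProbabilityMeasure_condLaw (hprob.trans_le hR')
    exact .of_smul_le hα.le hδ0 hδ1.le hδ' (R.ofReal_smul_condLaw_le hR)
      (R'.ofReal_smul_condLaw_le hR') (tradeoffTransfer_of_renyiDiv_le hα hdiv c' δ')
  · intro f g _ _ hf_le_one _
    calc ∫⁻ y, f y ∂ν ≤ ∫⁻ _, 1 ∂ν := lintegral_mono hf_le_one
      _ = 1 := by rw [lintegral_one, measure_univ]
      _ ≤ ENNReal.ofReal (δ + δ') := ENNReal.one_le_ofReal.2 (le_add_of_le_of_nonneg hδ1 hδ')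
      _ ≤ renyiTradeoff α (c + c') (δ + δ') (∫⁻ y, g y ∂ν') := le_add_self

end OutputWithEvent

namespace Analyst

variable {X : Type u} {Neighbor : X → X → Prop} {Y : Type v} [MeasurableSpace Y]
  {k : ℕ} {𝓔 : Fin k → ZCDPParam}

/-- The set of indices that the analyst has not selected in the first `n` rounds, given the
outcomes of these rounds. -/
def remaining (A : Analyst Neighbor Y 𝓔) : (n : ℕ) → n ≤ k → (Fin n → Y) → Finset (Fin k)
  | 0, _, _ => Finset.univ
  | n + 1, hn, h =>
      (A.remaining n (Nat.le_of_succ_le hn) (Fin.init h)).erase (A.index ⟨n, hn⟩ (Fin.init h))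

theorem index_mem_remaining_of_le (A : Analyst Neighbor Y 𝓔) {n : ℕ} (hn : n < k)
    (h : Fin n → Y) (m : ℕ) (hm : m ≤ n) :
    A.index ⟨n, hn⟩ h ∈ A.remaining m (hm.trans hn.le) fun l => h (Fin.castLE hm l) := by
  induction m with
  | zero => exact Finset.mem_univ _
  | succ m ih =>
    exact Finset.mem_erase.2
      ⟨(A.index_ne ⟨n, hn⟩ ⟨m, hm.trans hn.le⟩ hm h).symm, ih (Nat.le_of_succ_le hm)⟩

theorem index_mem_remaining (A : Analyst Neighbor Y 𝓔) {n : ℕ} (hn : n < k) (h : Fin n → Y) :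
    A.index ⟨n, hn⟩ h ∈ A.remaining n hn.le h :=
  A.index_mem_remaining_of_le hn h n le_rfl

theorem card_remaining_add (A : Analyst Neighbor Y 𝓔) (n : ℕ) (hn : n ≤ k) (h : Fin n → Y) :
    (A.remaining n hn h).card + n = k := by
  induction n with
  | zero => simp only [remaining, Finset.card_univ, Fintype.card_fin, add_zero]
  | succ n ih =>
    have hcard := Finset.card_erase_add_one (A.index_mem_remaining hn (Fin.init h))
    have hprev := ih (Nat.le_of_succ_le hn) (Fin.init h)
    simp only [remaining]
    omega

theorem remaining_eq_empty (A : Analyst Neighbor Y 𝓔) (h : Fin k → Y) :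
    A.remaining k le_rfl h = ∅ :=
  Finset.card_eq_zero.1 (Nat.add_eq_right.1 (A.card_remaining_add k le_rfl h))

theorem tradeoffTransfer_outcomeKernel (A : Analyst Neighbor Y 𝓔) (hδ : ∀ i, 0 ≤ (𝓔 i).δ)
    (b : Bool) {α : ℝ} (hα : 1 < α) (i : Fin k) (h : Fin i → Y) (c' : ℝ) {δ' : ℝ}
    (hδ' : 0 ≤ δ') :
    TradeoffTransfer (A.outcomeKernel b i h) (A.outcomeKernel (!b) i h)
      (fun _ => renyiTradeoff α c' δ')
      (renyiTradeoff α (α * (𝓔 (A.index i h)).ρ + (𝓔 (A.index i h)).ξ + c')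
        ((𝓔 (A.index i h)).δ + δ')) := by
  have := (A.isMarkovKernel_outcomeKernel b i).isProbabilityMeasure h
  obtain ⟨R, R', hR, hR', hdiv⟩ := A.mech_zCDP i h _ _ (A.neighbor i h)
  cases b
  · exact R.tradeoffTransfer R' hα (hδ _) hR hR' (hdiv α hα).1 c' hδ'
  · exact R'.tradeoffTransfer R hα (hδ _) hR' hR (hdiv α hα).2 c' hδ'

theorem tradeoffTransfer_viewUpTo (A : Analyst Neighbor Y 𝓔) (hδ : ∀ i, 0 ≤ (𝓔 i).δ) (b : Bool)
    {α : ℝ} (hα : 1 < α) (n : ℕ) (hn : n ≤ k) :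
    TradeoffTransfer (A.viewUpTo b n hn) (A.viewUpTo (!b) n hn)
      (fun h => renyiTradeoff α (∑ j ∈ A.remaining n hn h, (α * (𝓔 j).ρ + (𝓔 j).ξ))
        (∑ j ∈ A.remaining n hn h, (𝓔 j).δ))
      (renyiTradeoff α (∑ j, (α * (𝓔 j).ρ + (𝓔 j).ξ)) (∑ j, (𝓔 j).δ)) := by
  induction n with
  | zero => exact .dirac _ _
  | succ n ih =>
    have := A.isProbabilityMeasure_viewUpTo b n (Nat.le_of_succ_le hn)
    have := A.isProbabilityMeasure_viewUpTo (!b) n (Nat.le_of_succ_le hn)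
    have := A.isMarkovKernel_outcomeKernel b ⟨n, hn⟩
    have := A.isMarkovKernel_outcomeKernel (!b) ⟨n, hn⟩
    refine .map (measurable_snoc n) (.compProd (ih (Nat.le_of_succ_le hn)) fun h => ?_)
    have hmem := A.index_mem_remaining hn h
    simp only [remaining, Fin.init_snoc]
    rw [← Finset.add_sum_erase _ _ hmem, ← Finset.add_sum_erase _ _ hmem]
    exact A.tradeoffTransfer_outcomeKernel hδ b hα ⟨n, hn⟩ h _
      (Finset.sum_nonneg fun j _ => hδ j)

theorem view_real_le (A : Analyst Neighbor Y 𝓔) (hδ : ∀ i, 0 ≤ (𝓔 i).δ) (b : Bool) {α : ℝ}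
    (hα : 1 < α) {S : Set (Fin k → Y)} (hS : MeasurableSet S) :
    (A.view b).real S ≤
      (Real.exp (α * ∑ i, (𝓔 i).ρ + ∑ i, (𝓔 i).ξ) * (A.view (!b)).real S) ^ ((α - 1) / α) +
        ∑ i, (𝓔 i).δ := by
  have hsum : 0 ≤ ∑ i, (𝓔 i).δ := Finset.sum_nonneg fun i _ => hδ i
  have hview : A.view b S ≤ renyiTradeoff α (∑ i, (α * (𝓔 i).ρ + (𝓔 i).ξ)) (∑ i, (𝓔 i).δ)
      (A.view (!b) S) :=
    (A.tradeoffTransfer_viewUpTo hδ b hα k le_rfl).measure_le hS fun h _ => by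
      rw [A.remaining_eq_empty h, Finset.sum_empty, Finset.sum_empty, renyiTradeoff_zero_zero_one]
  rw [Finset.mul_sum, ← Finset.sum_add_distrib, measureReal_def, measureReal_def,
    ← toReal_renyiTradeoff hα.le hsum (measure_ne_top _ S)]
  exact ENNReal.toReal_mono (renyiTradeoff_ne_top hα.le (measure_ne_top _ S)) hview

end Analyst

theorem exp_mul_rpow_le {α c ε q : ℝ} (hα : 1 ≤ α) (hq : 0 ≤ q) :
    (Real.exp c * q) ^ ((α - 1) / α) ≤
      Real.exp ε * q + α⁻¹ * Real.exp ((α - 1) * (c - ε)) := by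
  have hα0 : 0 < α := one_pos.trans_le hα
  have hεq : 0 ≤ Real.exp ε * q := mul_nonneg (Real.exp_pos ε).le hq
  calc (Real.exp c * q) ^ ((α - 1) / α)
      = (Real.exp ε * q) ^ ((α - 1) / α) * Real.exp ((α - 1) * (c - ε)) ^ α⁻¹ := by
        rw [Real.mul_rpow (Real.exp_pos c).le hq, Real.mul_rpow (Real.exp_pos ε).le hq,
          ← Real.exp_mul, ← Real.exp_mul, ← Real.exp_mul, mul_right_comm, ← Real.exp_add]
        ring_nf
    _ ≤ (α - 1) / α * (Real.exp ε * q) + α⁻¹ * Real.exp ((α - 1) * (c - ε)) :=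
        Real.geom_mean_le_arith_mean2_weighted (sub_one_div_self_nonneg hα)
          (inv_pos.2 hα0).le hεq (Real.exp_pos _).le
          (by field_simp; ring)
    _ ≤ Real.exp ε * q + α⁻¹ * Real.exp ((α - 1) * (c - ε)) := by
        gcongr ?_ + _
        exact mul_le_of_le_one_left hεq (sub_one_div_self_le_one hα0.le)

theorem exists_order_exp_mul_rpow_le {ρ δ q : ℝ} (ξ : ℝ) (hρ : 0 ≤ ρ) (hδ0 : 0 < δ)
    (hδ1 : δ < 1) (hq : 0 ≤ q) :
    ∃ α : ℝ, 1 < α ∧ (Real.exp (α * ρ + ξ) * q) ^ ((α - 1) / α) ≤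
      Real.exp (ξ + ρ + 2 * √(ρ * Real.log (1 / δ))) * q + δ := by
  have hδ_inv : 1 < 1 / δ := one_lt_one_div hδ0 hδ1
  rcases hρ.eq_or_lt with rfl | hρ
  · -- The exponent vanishes, and the factor `α⁻¹` in Young's inequality has to produce `δ`.
    refine ⟨1 / δ, hδ_inv, (exp_mul_rpow_le (ε := ξ) hδ_inv.le hq).trans_eq ?_⟩
    simp
  · obtain ⟨r, hr, rfl⟩ : ∃ r, 0 < r ∧ ρ = r ^ 2 :=
      ⟨√ρ, Real.sqrt_pos.2 hρ, (Real.sq_sqrt hρ.le).symm⟩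
    obtain ⟨l, hl, hlog⟩ : ∃ l, 0 < l ∧ Real.log (1 / δ) = l ^ 2 :=
      ⟨√(Real.log (1 / δ)), Real.sqrt_pos.2 (Real.log_pos hδ_inv),
        (Real.sq_sqrt (Real.log_pos hδ_inv).le).symm⟩
    have hδ_eq : δ = Real.exp (-l ^ 2) := by
      rw [← hlog, one_div, Real.log_inv, neg_neg, Real.exp_log hδ0]
    rw [hlog, ← mul_pow, Real.sqrt_sq (mul_pos hr hl).le]
    have hα : 1 < 1 + l / r := lt_add_of_pos_right 1 (div_pos hl hr)
    -- This order minimises the exponent `(α - 1) * (α * r ^ 2 + ξ - ε)`.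
    refine ⟨1 + l / r, hα, (exp_mul_rpow_le (ε := ξ + r ^ 2 + 2 * (r * l)) hα.le hq).trans ?_⟩
    have hexp : (1 + l / r - 1) * ((1 + l / r) * r ^ 2 + ξ - (ξ + r ^ 2 + 2 * (r * l))) =
        -l ^ 2 := by
      field_simp
      ring
    rw [hexp, ← hδ_eq]
    gcongr
    exact mul_le_of_le_one_left hδ0.le (inv_le_one_of_one_le₀ hα.le)

end SetwiseComposition

theorem mainTheorem6 {X : Type u} (Neighbor : X → X → Prop) (Y : Type v) [MeasurableSpace Y]
    {k : ℕ} (𝓔 : Fin k → SetwiseComposition.ZCDPParam)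
    (hδ : ∀ i, 0 ≤ (𝓔 i).δ) (hρ : ∀ i, 0 ≤ (𝓔 i).ρ) (δ : ℝ) (hδ_pos : 0 < δ) :
    SetwiseComposition.IsSetwiseAdaptiveDP Neighbor Y 𝓔
      (∑ i, ((𝓔 i).ξ + (𝓔 i).ρ) + 2 * Real.sqrt (∑ i, (𝓔 i).ρ * Real.log (1 / δ)))
      (δ + ∑ i, (𝓔 i).δ) := by
  intro A b S hS
  have hq : 0 ≤ (A.view (!b)).real S := measureReal_nonneg
  rcases lt_or_ge δ 1 with hδ1 | hδ1
  · obtain ⟨α, hα, hyoung⟩ := SetwiseComposition.exists_order_exp_mul_rpow_le (∑ i, (𝓔 i).ξ)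
      (Finset.sum_nonneg fun i _ => hρ i) hδ_pos hδ1 hq
    rw [Finset.sum_add_distrib, ← Finset.sum_mul, ← add_assoc]
    exact (A.view_real_le hδ b hα hS).trans (by gcongr)
  · calc (A.view b).real S ≤ 1 := measureReal_le_one
      _ ≤ δ + ∑ i, (𝓔 i).δ := le_add_of_le_of_nonneg hδ1 (Finset.sum_nonneg fun i _ => hδ i)
      _ ≤ _ := le_add_of_nonneg_left (mul_nonneg (Real.exp_pos _).le hq)
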